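/- Let $b>0$. For $\nu\in\mathbb{C}$ let $y_{\mathrm{even}}(\nu,\cdot)$ and $y_{\mathrm{odd}}(\nu,\cdot)$ be the solutions of Weber's equation $-y''(x)+\left(\frac{x^2}{4}-\frac12\right)y(x)=\nu y(x)$ given by $$y_{\mathrm{even}}(\nu,x)=e^{-x^2/4}\Big[1+(-\nu)\frac{x^2}{2!}+(-\nu)(-\nu+2)\frac{x^4}{4!}+\cdots\Big],\qquad y_{\mathrm{odd}}(\nu,x)=e^{-x^2/4}\Big[x+(-\nu+1)\frac{x^3}{3!}+(-\nu+1)(-\nu+3)\frac{x^5}{5!}+\cdots\Big],$$ and let $$D_\nu(x)=\frac{2^{\nu/2}\sqrt{\pi}}{\Gamma\left(-\frac{\nu}{2}+\frac12\right)}\,y_{\mathrm{even}}(\nu,x)-\frac{2^{(\nu+1)/2}\sqrt{\pi}}{\Gamma\left(-\frac{\nu}{2}\right)}\,y_{\mathrm{odd}}(\nu,x)$$ be the parabolic cylinder function, where $1/\Gamma$ denotes the entire reciprocal Gamma function. For $\nu\in\mathbb{C}\setminus\{0,1,2,\dots\}$ put $$M(\nu)=\sqrt{\tfrac{2}{\pi}}\;\Gamma(-\nu)\,D_\nu(b)^2\,y_{\mathrm{even}}(\nu,b)\,y_{\mathrm{odd}}(\nu,b).$$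 (i) If $\lambda\in\mathbb{C}$ and $D_\lambda(b)=0$, then $\lambda$ is real and $\lambda>0$. (ii) If $\lambda\in\mathbb{R}$ is not a positive integer and $D_\lambda(b)=0$, then $\lambda$ is a simple zero of the holomorphic function $\nu\mapsto D_\nu(b)$. (iii) If $\lambda\in\mathbb{R}$ is not a positive integer and $D_\lambda(b)=0$, then $M$ is holomorphic near $\lambda$, and in its local expansion $$M(\nu)=c_2(\nu-\lambda)^2+O\big((\nu-\lambda)^3\big),\qquad \nu\to\lambda,\ \nu\in\mathbb{C},$$ the coefficient $c_2$ is real and $c_2>0$. -/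

import Mathlib

open scoped Topology
open Asymptotics

namespace Weber

/-- The power-series coefficient `(-ν)(-ν+2)⋯(-ν+2k-2) / (2k)!` of `x ^ (2k)`. -/
noncomputable def evenCoeff (ν : ℂ) (k : ℕ) : ℂ :=
  (∏ j ∈ Finset.range k, (-ν + 2 * (j : ℂ))) / ((2 * k).factorial : ℂ)

/-- The power-series coefficient `(-ν+1)(-ν+3)⋯(-ν+2k-1) / (2k+1)!` of `x ^ (2k+1)`. -/
noncomputable def oddCoeff (ν : ℂ) (k : ℕ) : ℂ :=
  (∏ j ∈ Finset.range k, (-ν + 1 + 2 * (j : ℂ))) / ((2 * k + 1).factorial : ℂ)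

/-- The even solution of Weber's equation `-y'' + (x²/4 - 1/2) y = ν y`, with
`y(0) = 1`, `y'(0) = 0`:
`exp(-x²/4) [1 + (-ν) x²/2! + (-ν)(-ν+2) x⁴/4! + ⋯]`. -/
noncomputable def yEven (ν x : ℂ) : ℂ :=
  Complex.exp (-x ^ 2 / 4) * ∑' k : ℕ, evenCoeff ν k * x ^ (2 * k)

/-- The odd solution of Weber's equation `-y'' + (x²/4 - 1/2) y = ν y`, with
`y(0) = 0`, `y'(0) = 1`:
`exp(-x²/4) [x + (-ν+1) x³/3! + (-ν+1)(-ν+3) x⁵/5! + ⋯]`. -/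
noncomputable def yOdd (ν x : ℂ) : ℂ :=
  Complex.exp (-x ^ 2 / 4) * ∑' k : ℕ, oddCoeff ν k * x ^ (2 * k + 1)

/-- The value `D_ν(0) = 2^(ν/2) √π / Γ((1-ν)/2)`. At the poles of `Γ`, Mathlib's `Gamma` is `0`
and so is its inverse, so `(Gamma s)⁻¹` is the entire function `1/Γ(s)`. -/
noncomputable def dValue (ν : ℂ) : ℂ :=
  (2 : ℂ) ^ (ν / 2) * (Real.sqrt Real.pi : ℂ) * (Complex.Gamma (-ν / 2 + 1 / 2))⁻¹

/-- The derivative `(d/dx) D_ν(x)` at `x = 0`, that is `-2^((ν+1)/2) √π / Γ(-ν/2)`. -/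
noncomputable def dSlope (ν : ℂ) : ℂ :=
  -((2 : ℂ) ^ ((ν + 1) / 2) * (Real.sqrt Real.pi : ℂ) * (Complex.Gamma (-ν / 2))⁻¹)

/-- The parabolic cylinder function `D_ν(x)`: the solution of Weber's equation whose value and
derivative at `0` are `dValue ν` and `dSlope ν`. -/
noncomputable def parabolicD (ν x : ℂ) : ℂ :=
  dValue ν * yEven ν x + dSlope ν * yOdd ν x

/-- `M(ν; b) = √(2/π) Γ(-ν) D_ν(b)² y_even(ν, b) y_odd(ν, b)`, meromorphic in `ν`, with poles at
most at the non-negative integers (where the value in Lean is meaningless). -/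
noncomputable def eigM (b : ℝ) (ν : ℂ) : ℂ :=
  (Real.sqrt (2 / Real.pi) : ℂ) * Complex.Gamma (-ν) * parabolicD ν (b : ℂ) ^ 2
    * yEven ν (b : ℂ) * yOdd ν (b : ℂ)

/-- Ratio-test helper for the two series below. -/
theorem summable_coeff_aux (a : ℂ) (c : ℕ → ℕ) (hc : ∀ k, 0 < c k) (hc2 : ∀ k, (k+1)*(k+1) * c k ≤ c (k+1)) (x : ℂ) (e:ℕ) :
   Summable fun k : ℕ => (∏ j ∈ Finset.range k, (a + 2 * (j : ℂ))) / (c k : ℂ) * x ^ (2 * k + e) := by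
  have hlim : Filter.Tendsto (fun k : ℕ => (‖a‖ + 2) * ‖x‖^2 * (1 / ((k:ℝ)+1))) Filter.atTop (𝓝 ((‖a‖ + 2) * ‖x‖^2 * 0)) :=
    tendsto_one_div_add_atTop_nhds_zero_nat.const_mul _
  rw [mul_zero] at hlim
  refine summable_of_ratio_norm_eventually_le (r := 1/2) (by norm_num) ?_
  filter_upwards [hlim.eventually_le_const (show (0:ℝ) < 1/2 by norm_num)] with k hk
  have h1 : ‖a + 2 * (k:ℂ)‖ ≤ (‖a‖ + 2) * ((k:ℝ)+1) := by
    refine (norm_add_le _ _).trans ?_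
    simp only [norm_mul, Complex.norm_natCast, Complex.norm_ofNat]
    nlinarith [norm_nonneg a, (Nat.cast_nonneg k : (0:ℝ) ≤ k), mul_nonneg (norm_nonneg a) (Nat.cast_nonneg k : (0:ℝ) ≤ k)]
  have hk0 : (0:ℝ) < (k:ℝ)+1 := by positivity
  have hcp : (0:ℝ) < c k := by exact_mod_cast hc k
  have h2 : ((k:ℝ)+1)*((k:ℝ)+1) * c k ≤ c (k+1) := by exact_mod_cast hc2 k
  rw [Finset.prod_range_succ]
  simp only [norm_mul, norm_div, norm_pow, Complex.norm_natCast]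
  set P := ‖∏ j ∈ Finset.range k, (a + 2 * (j : ℂ))‖
  calc P * ‖a + 2 * (k:ℂ)‖ / (c (k+1) : ℝ) * ‖x‖ ^ (2*(k+1)+e)
      ≤ P * ((‖a‖ + 2) * ((k:ℝ)+1)) / (((k:ℝ)+1)*((k:ℝ)+1) * c k) * ‖x‖ ^ (2*(k+1)+e) := by
        gcongr
    _ = ((‖a‖ + 2) * ‖x‖^2 * (1 / ((k:ℝ)+1))) * (P / c k * ‖x‖ ^ (2*k+e)) := by
        field_simp
        ring
    _ ≤ 1/2 * (P / c k * ‖x‖ ^ (2*k+e)) := by gcongr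

/-- The series in `yEven` converges everywhere. -/
theorem summable_evenCoeff (ν x : ℂ) : Summable fun k : ℕ => evenCoeff ν k * x ^ (2 * k) := by
  refine summable_coeff_aux (-ν) (fun k => (2 * k).factorial) (fun k => Nat.factorial_pos _)
    (fun k => ?_) x 0
  rw [show 2 * (k + 1) = 2 * k + 1 + 1 by ring, Nat.factorial_succ, Nat.factorial_succ,
    ← mul_assoc]
  gcongr <;> omega

/-- The series in `yOdd` converges everywhere. -/
theorem summable_oddCoeff (ν x : ℂ) : Summable fun k : ℕ => oddCoeff ν k * x ^ (2 * k + 1) := by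
  refine summable_coeff_aux (-ν + 1) (fun k => (2 * k + 1).factorial)
    (fun k => Nat.factorial_pos _) (fun k => ?_) x 1
  rw [show 2 * (k + 1) + 1 = 2 * k + 1 + 1 + 1 by ring, Nat.factorial_succ (2 * k + 1 + 1),
    Nat.factorial_succ (2 * k + 1), ← mul_assoc]
  gcongr <;> omega

end Weber

/-!
The operators `x/2 + d/dx` and `x/2 - d/dx` send `D_ν` to `ν D_{ν-1}` and to `D_{ν+1}`, and
`D_ν(x)` decays rapidly as `x → ∞`: for `Re ν < 0` this follows from
`Γ(-ν) D_ν(x) = e^{-x²/4} ∫₀^∞ t^{-ν-1} e^{-xt-t²/2} dt`, and the three-term recurrence in `ν`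
carries it over to all `ν`, locally uniformly.

If `D_λ(b) = 0`, integrating by parts on `(b, ∞)` gives `conj λ ‖D_{λ-1}‖² = ‖D_λ‖²` in
`L²(b, ∞)`, and `D_{λ-1}(b) ≠ 0` because the Wronskian of `D_λ` with a second solution does not
vanish; so `λ` is real and positive. Dividing
`(λ - ν) ∫_b^∞ D_λ D_ν = -D_{λ+1}(b) D_ν(b)` by `λ - ν` and letting `ν → λ` gives
`∂_ν D_ν(b) ≠ 0` at `λ`, so the zero is simple.

For the sign of `c₂`, write `α = D_λ(0)` and `β = (d/dx) D_λ(0)`. The duplication formula gives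
`√(2/π) Γ(-λ) α β = -1`, and `α y_even + β y_odd = 0` at `b`; hence the factor of `D_ν(b)²` in `M`
equals `(y_odd(λ, b) / α)²` at `λ`, and `c₂` is the square of a nonzero real number.
-/

namespace Weber

open Complex (Gamma)
open ComplexConjugate Filter MeasureTheory Set

/-! ### Power series -/

theorem mul_prod_range_add_two (a : ℂ) (k : ℕ) :
    a * ∏ j ∈ Finset.range k, (a + 2 + 2 * (j : ℂ)) =
      (∏ j ∈ Finset.range k, (a + 2 * (j : ℂ))) * (a + 2 * k) := by
  rw [← Finset.prod_range_succ (fun j : ℕ => a + 2 * (j : ℂ)), Finset.prod_range_succ', mul_comm]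
  congr 1
  · exact Finset.prod_congr rfl fun j _ => by push_cast; ring
  · simp

theorem oddCoeff_mul (ν : ℂ) (k : ℕ) : oddCoeff ν k * (2 * k + 1) = evenCoeff (ν - 1) k := by
  have hk : (2 * k + 1 : ℂ) ≠ 0 := by exact_mod_cast Nat.succ_ne_zero (2 * k)
  rw [oddCoeff, evenCoeff, Nat.factorial_succ, neg_sub, sub_eq_neg_add]
  push_cast
  field_simp

theorem evenCoeff_succ_mul (ν : ℂ) (k : ℕ) :
    evenCoeff ν (k + 1) * (2 * k + 2) = -ν * oddCoeff (ν - 1) k := by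
  have hk : (2 * k + 1 + 1 : ℂ) ≠ 0 := by exact_mod_cast Nat.succ_ne_zero (2 * k + 1)
  rw [evenCoeff, oddCoeff, Finset.prod_range_succ, ← mul_prod_range_add_two,
    show -(ν - 1) + 1 = -ν + 2 by ring, Nat.mul_succ, Nat.factorial_succ]
  push_cast
  field_simp
  ring

theorem evenCoeff_sub_two_succ_mul (ν : ℂ) (k : ℕ) :
    evenCoeff (ν - 2) (k + 1) * (2 * k + 2) = (2 * k + 2 - ν) * oddCoeff (ν - 1) k := by
  have hk : (2 * k + 1 + 1 : ℂ) ≠ 0 := by exact_mod_cast Nat.succ_ne_zero (2 * k + 1)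
  rw [evenCoeff, oddCoeff, Finset.prod_range_succ, show -(ν - 2) = -ν + 2 by ring,
    show -(ν - 1) + 1 = -ν + 2 by ring, Nat.mul_succ, Nat.factorial_succ]
  push_cast
  field_simp
  ring

theorem sub_one_mul_oddCoeff_sub_two (ν : ℂ) (k : ℕ) :
    (ν - 1) * oddCoeff (ν - 2) k = (ν - 1 - 2 * k) * oddCoeff ν k := by
  have hprod := mul_prod_range_add_two (-ν + 1) k
  rw [oddCoeff, oddCoeff, show -(ν - 2) + 1 = -ν + 1 + 2 by ring]
  linear_combination -(1 / ((2 * k + 1).factorial : ℂ)) * hprod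

theorem evenCoeff_succ_eq_sub (ν : ℂ) (k : ℕ) :
    evenCoeff ν (k + 1) = evenCoeff (ν - 2) (k + 1) - oddCoeff (ν - 1) k := by
  have hk : (2 * k + 2 : ℂ) ≠ 0 := by exact_mod_cast Nat.succ_ne_zero (2 * k + 1)
  refine mul_right_cancel₀ hk ?_
  linear_combination evenCoeff_succ_mul ν k - evenCoeff_sub_two_succ_mul ν k

theorem mul_oddCoeff_eq_add (ν : ℂ) (k : ℕ) :
    ν * oddCoeff ν k = evenCoeff (ν - 1) k + (ν - 1) * oddCoeff (ν - 2) k := by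
  rw [← oddCoeff_mul, sub_one_mul_oddCoeff_sub_two]
  ring

/-- The power series in `yEven`, without the Gaussian factor. -/
noncomputable def evenSeries (ν x : ℂ) : ℂ := ∑' k : ℕ, evenCoeff ν k * x ^ (2 * k)

/-- The power series in `yOdd`, without the Gaussian factor. -/
noncomputable def oddSeries (ν x : ℂ) : ℂ := ∑' k : ℕ, oddCoeff ν k * x ^ (2 * k + 1)

theorem evenSeries_eq_one_add (ν x : ℂ) :
    evenSeries ν x = 1 + ∑' k : ℕ, evenCoeff ν (k + 1) * x ^ (2 * (k + 1)) := by
  rw [evenSeries, (summable_evenCoeff ν x).tsum_eq_zero_add]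
  simp [evenCoeff]

theorem evenSeries_eq_sub (ν x : ℂ) :
    evenSeries ν x = evenSeries (ν - 2) x - x * oddSeries (ν - 1) x := by
  have htail := (summable_nat_add_iff 1).2 (summable_evenCoeff (ν - 2) x)
  rw [evenSeries_eq_one_add, evenSeries_eq_one_add (ν - 2), oddSeries, ← tsum_mul_left,
    add_sub_assoc, ← htail.tsum_sub ((summable_oddCoeff (ν - 1) x).mul_left x)]
  refine congrArg (1 + ·) (tsum_congr fun k => ?_)
  rw [evenCoeff_succ_eq_sub]
  ring

theorem mul_oddSeries_eq_add (ν x : ℂ) :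
    ν * oddSeries ν x = x * evenSeries (ν - 1) x + (ν - 1) * oddSeries (ν - 2) x := by
  simp only [oddSeries, evenSeries, ← tsum_mul_left]
  rw [← ((summable_evenCoeff (ν - 1) x).mul_left x).tsum_add
    ((summable_oddCoeff (ν - 2) x).mul_left _)]
  refine tsum_congr fun k => ?_
  rw [← mul_assoc, mul_oddCoeff_eq_add]
  ring

theorem hasDerivAt_tsum_mul_pow {𝕜 ι : Type*} [RCLike 𝕜] {a : ι → 𝕜} {m : ι → ℕ} {x : 𝕜}
    (hx : Summable fun i => a i * x ^ m i)
    (hderiv : ∀ y : 𝕜, Summable fun i => a i * (m i * y ^ (m i - 1))) :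
    HasDerivAt (fun y => ∑' i, a i * y ^ m i) (∑' i, a i * (m i * x ^ (m i - 1))) x := by
  set R : 𝕜 := ((‖x‖ + 1 : ℝ) : 𝕜) with hR
  have hRnorm : ‖R‖ = ‖x‖ + 1 := by rw [hR, RCLike.norm_ofReal, abs_of_nonneg (by positivity)]
  have hxR : x ∈ Metric.ball (0 : 𝕜) ‖R‖ := by simp [hRnorm]
  refine hasDerivAt_tsum_of_isPreconnected (hderiv R).norm Metric.isOpen_ball
    (Metric.isPreconnected_ball) (fun i y _ => (hasDerivAt_pow (m i) y).const_mul (a i))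
    (fun i y hy => ?_) hxR hx hxR
  simp only [norm_mul, norm_pow]
  gcongr
  exact (mem_ball_zero_iff.1 hy).le

theorem hasDerivAt_oddSeries (ν x : ℂ) : HasDerivAt (oddSeries ν) (evenSeries (ν - 1) x) x := by
  have hterm (y : ℂ) (k : ℕ) : oddCoeff ν k * (((2 * k + 1 : ℕ) : ℂ) * y ^ (2 * k + 1 - 1)) =
      evenCoeff (ν - 1) k * y ^ (2 * k) := by
    rw [← oddCoeff_mul, Nat.add_sub_cancel]
    push_cast
    ring
  refine (hasDerivAt_tsum_mul_pow (summable_oddCoeff ν x) fun y => ?_).congr_deriv ?_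
  · simpa only [hterm] using summable_evenCoeff (ν - 1) y
  · exact tsum_congr (hterm x)

theorem hasDerivAt_evenSeries (ν x : ℂ) :
    HasDerivAt (evenSeries ν) (-ν * oddSeries (ν - 1) x) x := by
  have hterm (y : ℂ) (k : ℕ) :
      evenCoeff ν (k + 1) * (((2 * (k + 1) : ℕ) : ℂ) * y ^ (2 * (k + 1) - 1)) =
        -ν * (oddCoeff (ν - 1) k * y ^ (2 * k + 1)) := by
    rw [← mul_assoc (-ν), ← evenCoeff_succ_mul, show 2 * (k + 1) - 1 = 2 * k + 1 by omega]
    push_cast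
    ring
  rw [funext (evenSeries_eq_one_add ν)]
  refine ((hasDerivAt_tsum_mul_pow (a := fun k => evenCoeff ν (k + 1)) (m := fun k => 2 * (k + 1))
    ((summable_nat_add_iff (f := fun k => evenCoeff ν k * x ^ (2 * k)) 1).2
      (summable_evenCoeff ν x)) fun y => ?_).const_add 1).congr_deriv ?_
  · simpa only [hterm] using (summable_oddCoeff (ν - 1) y).mul_left (-ν)
  · rw [oddSeries, ← tsum_mul_left]
    exact tsum_congr (hterm x)

/-! ### Ladder relations -/

theorem yEven_eq (ν x : ℂ) : yEven ν x = Complex.exp (-x ^ 2 / 4) * evenSeries ν x := rfl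

theorem yOdd_eq (ν x : ℂ) : yOdd ν x = Complex.exp (-x ^ 2 / 4) * oddSeries ν x := rfl

theorem hasDerivAt_exp_neg_sq_div_four (x : ℂ) :
    HasDerivAt (fun x : ℂ => Complex.exp (-x ^ 2 / 4)) (-(x / 2) * Complex.exp (-x ^ 2 / 4)) x := by
  refine ((hasDerivAt_pow 2 x).fun_neg.div_const 4).cexp.congr_deriv ?_
  push_cast
  ring

theorem hasDerivAt_yEven (ν x : ℂ) :
    HasDerivAt (yEven ν) (-(x / 2) * yEven ν x - ν * yOdd (ν - 1) x) x := by
  refine ((hasDerivAt_exp_neg_sq_div_four x).mul (hasDerivAt_evenSeries ν x)).congr_deriv ?_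
  rw [yEven_eq, yOdd_eq]
  ring

theorem hasDerivAt_yOdd (ν x : ℂ) :
    HasDerivAt (yOdd ν) (-(x / 2) * yOdd ν x + yEven (ν - 1) x) x := by
  refine ((hasDerivAt_exp_neg_sq_div_four x).mul (hasDerivAt_oddSeries ν x)).congr_deriv ?_
  rw [yEven_eq, yOdd_eq]
  ring

theorem yEven_eq_sub (ν x : ℂ) : yEven ν x = yEven (ν - 2) x - x * yOdd (ν - 1) x := by
  simp only [yEven_eq, yOdd_eq]
  linear_combination Complex.exp (-x ^ 2 / 4) * evenSeries_eq_sub ν x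

theorem mul_yOdd_eq_add (ν x : ℂ) :
    ν * yOdd ν x = x * yEven (ν - 1) x + (ν - 1) * yOdd (ν - 2) x := by
  simp only [yEven_eq, yOdd_eq]
  linear_combination Complex.exp (-x ^ 2 / 4) * mul_oddSeries_eq_add ν x

@[simp] theorem yEven_zero (ν : ℂ) : yEven ν 0 = 1 := by simp [yEven_eq, evenSeries_eq_one_add]

@[simp] theorem yOdd_zero (ν : ℂ) : yOdd ν 0 = 0 := by simp [yOdd]

/-- By the derivative formulas the left-hand side is the Wronskian
`yEven ν · (yOdd ν)' - (yEven ν)' · yOdd ν`. -/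
theorem wronskian_yEven_yOdd (ν x : ℂ) :
    yEven ν x * yEven (ν - 1) x + ν * yOdd (ν - 1) x * yOdd ν x = 1 := by
  have hconst (z : ℂ) : HasDerivAt
      (fun z => yEven ν z * yEven (ν - 1) z + ν * yOdd (ν - 1) z * yOdd ν z) 0 z := by
    refine (((hasDerivAt_yEven ν z).mul (hasDerivAt_yEven (ν - 1) z)).add
      (((hasDerivAt_yOdd (ν - 1) z).const_mul ν).mul (hasDerivAt_yOdd ν z))).congr_deriv ?_
    rw [show ν - 1 - 1 = ν - 2 by ring]
    linear_combination (-ν * yOdd ν z) * yEven_eq_sub ν z + yEven ν z * mul_yOdd_eq_add ν z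
  have hzero := is_const_of_deriv_eq_zero (fun z => (hconst z).differentiableAt)
    (fun z => (hconst z).deriv) x 0
  simpa using hzero

theorem yOdd_ne_zero_of_yEven_eq_zero {ν x : ℂ} (h : yEven ν x = 0) : yOdd ν x ≠ 0 := fun h' => by
  simpa [h, h'] using wronskian_yEven_yOdd ν x

theorem dSlope_eq_mul_dValue (ν : ℂ) : dSlope ν = ν * dValue (ν - 1) := by
  have hGamma := Complex.one_div_Gamma_eq_self_mul_one_div_Gamma_add_one (-ν / 2)
  have hpow : (2 : ℂ) ^ ((ν + 1) / 2) = 2 ^ ((ν - 1) / 2) * 2 := by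
    rw [show (ν + 1) / 2 = (ν - 1) / 2 + 1 by ring, Complex.cpow_add _ _ two_ne_zero,
      Complex.cpow_one]
  rw [dSlope, dValue, hGamma, hpow, show -(ν - 1) / 2 + 1 / 2 = -ν / 2 + 1 by ring]
  ring

theorem dSlope_sub_one (ν : ℂ) : dSlope (ν - 1) = -dValue ν := by
  rw [dSlope, dValue, sub_add_cancel, show -(ν - 1) / 2 = -ν / 2 + 1 / 2 by ring]

theorem hasDerivAt_parabolicD (ν x : ℂ) :
    HasDerivAt (parabolicD ν) (-(x / 2) * parabolicD ν x + ν * parabolicD (ν - 1) x) x := by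
  refine (((hasDerivAt_yEven ν x).const_mul (dValue ν)).add
    ((hasDerivAt_yOdd ν x).const_mul (dSlope ν))).congr_deriv ?_
  rw [parabolicD, parabolicD, dSlope_sub_one, dSlope_eq_mul_dValue]
  ring

theorem parabolicD_eq_sub (ν x : ℂ) :
    parabolicD ν x = x * parabolicD (ν - 1) x - (ν - 1) * parabolicD (ν - 2) x := by
  have hslope := dSlope_sub_one (ν - 1)
  have hvalue := dSlope_eq_mul_dValue (ν - 1)
  rw [show ν - 1 - 1 = ν - 2 by ring] at hslope hvalue
  rw [dSlope_sub_one] at hvalue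
  simp only [parabolicD]
  rw [dSlope_eq_mul_dValue ν, hslope, dSlope_sub_one]
  linear_combination dValue ν * yEven_eq_sub ν x + dValue (ν - 1) * mul_yOdd_eq_add ν x -
    yEven (ν - 2) x * hvalue

theorem hasDerivAt_parabolicD' (ν x : ℂ) :
    HasDerivAt (parabolicD ν) (x / 2 * parabolicD ν x - parabolicD (ν + 1) x) x := by
  have hrec := parabolicD_eq_sub (ν + 1) x
  rw [add_sub_cancel_right, show ν + 1 - 2 = ν - 1 by ring] at hrec
  refine (hasDerivAt_parabolicD ν x).congr_deriv ?_
  linear_combination hrec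

theorem two_cpow_ne_zero (z : ℂ) : (2 : ℂ) ^ z ≠ 0 := by simp [Complex.cpow_eq_zero_iff]

theorem sqrt_pi_ne_zero : (Real.sqrt Real.pi : ℂ) ≠ 0 := by
  exact_mod_cast (Real.sqrt_pos.2 Real.pi_pos).ne'

theorem dSlope_ne_zero_of_dValue_eq_zero {ν : ℂ} (h : dValue ν = 0) : dSlope ν ≠ 0 := by
  intro h'
  simp only [dValue, dSlope, neg_eq_zero, mul_eq_zero, two_cpow_ne_zero, sqrt_pi_ne_zero,
    inv_eq_zero, false_or, Complex.Gamma_eq_zero_iff] at h h'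
  obtain ⟨m, hm⟩ := h
  obtain ⟨n, hn⟩ := h'
  have hparity : (2 * m + 1 : ℂ) = 2 * n := by linear_combination 2 * hm - 2 * hn
  have : 2 * m + 1 = 2 * n := by exact_mod_cast hparity
  omega

theorem mul_parabolicD_sub_one_ne_zero {ν x : ℂ} (h : parabolicD ν x = 0) :
    ν * parabolicD (ν - 1) x ≠ 0 := by
  intro h'
  rw [parabolicD, dSlope_sub_one] at h'
  have hderiv : -dValue ν * (ν * yOdd (ν - 1) x) + dSlope ν * yEven (ν - 1) x = 0 := by
    rw [dSlope_eq_mul_dValue]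
    linear_combination h'
  rw [parabolicD] at h
  have hW := wronskian_yEven_yOdd ν x
  refine dSlope_ne_zero_of_dValue_eq_zero (ν := ν) ?_ ?_
  · linear_combination -dValue ν * hW + yEven (ν - 1) x * h - yOdd ν x * hderiv
  · linear_combination -dSlope ν * hW + ν * yOdd (ν - 1) x * h + yEven ν x * hderiv

/-! ### Dependence on the order -/

theorem differentiable_tsum_prod_range_mul {c : ℕ → ℝ} (hc : ∀ j, 0 ≤ c j) {u : ℕ → ℂ}
    (hu : ∀ a : ℂ, Summable fun k => (∏ j ∈ Finset.range k, (a + c j)) * u k) :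
    Differentiable ℂ fun a : ℂ => ∑' k, (∏ j ∈ Finset.range k, (a + c j)) * u k := fun a => by
  have hle {R : ℝ} {w : ℂ} (hw : ‖w‖ ≤ R) (j : ℕ) : ‖w + c j‖ ≤ ‖(R : ℂ) + c j‖ := by
    have hR : 0 ≤ R + c j := add_nonneg ((norm_nonneg w).trans hw) (hc j)
    rw [← Complex.ofReal_add, Complex.norm_of_nonneg hR]
    refine (norm_add_le _ _).trans (add_le_add hw ?_)
    rw [Complex.norm_of_nonneg (hc j)]
  refine (Complex.differentiableOn_tsum_of_summable_norm (hu ((‖a‖ + 1 : ℝ) : ℂ)).norm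
    (U := Metric.ball 0 (‖a‖ + 1)) (fun k => ?_) Metric.isOpen_ball fun k w hw => ?_
    ).differentiableAt (Metric.isOpen_ball.mem_nhds (by simp))
  · fun_prop
  · rw [norm_mul, norm_mul, norm_prod, norm_prod]
    gcongr
    exact hle (mem_ball_zero_iff.1 hw).le _

theorem differentiable_yEven_left (x : ℂ) : Differentiable ℂ fun ν => yEven ν x := by
  have hcoeff (ν : ℂ) (k : ℕ) : evenCoeff ν k * x ^ (2 * k) =
      (∏ j ∈ Finset.range k, (-ν + (2 * j : ℝ))) * (x ^ (2 * k) / (2 * k).factorial) := by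
    rw [evenCoeff]
    push_cast
    ring
  have hdiff : Differentiable ℂ fun a : ℂ => ∑' k : ℕ,
      (∏ j ∈ Finset.range k, (a + (2 * j : ℝ))) * (x ^ (2 * k) / (2 * k).factorial) :=
    differentiable_tsum_prod_range_mul (fun j => by positivity) fun a => by
      simpa only [hcoeff, neg_neg] using summable_evenCoeff (-a) x
  simp only [yEven, hcoeff]
  exact (hdiff.comp differentiable_neg).const_mul _

theorem differentiable_yOdd_left (x : ℂ) : Differentiable ℂ fun ν => yOdd ν x := by
  have hcoeff (ν : ℂ) (k : ℕ) : oddCoeff ν k * x ^ (2 * k + 1) =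
      (∏ j ∈ Finset.range k, (1 - ν + (2 * j : ℝ))) *
        (x ^ (2 * k + 1) / (2 * k + 1).factorial) := by
    rw [oddCoeff, sub_eq_neg_add]
    push_cast
    ring
  have hdiff : Differentiable ℂ fun a : ℂ => ∑' k : ℕ,
      (∏ j ∈ Finset.range k, (a + (2 * j : ℝ))) * (x ^ (2 * k + 1) / (2 * k + 1).factorial) :=
    differentiable_tsum_prod_range_mul (fun j => by positivity) fun a => by
      simpa only [hcoeff, sub_sub_cancel] using summable_oddCoeff (1 - a) x
  simp only [yOdd, hcoeff]
  exact (hdiff.comp (differentiable_id.const_sub 1)).const_mul _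

theorem differentiable_dValue : Differentiable ℂ dValue :=
  (((differentiable_id.div_const 2).const_cpow (.inl two_ne_zero)).mul_const _).mul
    (Complex.differentiable_one_div_Gamma.comp ((differentiable_neg.div_const 2).add_const _))

theorem differentiable_dSlope : Differentiable ℂ dSlope :=
  ((((differentiable_id.add_const 1).div_const 2).const_cpow (.inl two_ne_zero)).mul_const _
    |>.mul (Complex.differentiable_one_div_Gamma.comp (differentiable_neg.div_const 2))).neg

theorem differentiable_parabolicD_left (x : ℂ) : Differentiable ℂ fun ν => parabolicD ν x :=
  (differentiable_dValue.mul (differentiable_yEven_left x)).add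
    (differentiable_dSlope.mul (differentiable_yOdd_left x))

theorem conj_yEven (ν x : ℂ) : conj (yEven ν x) = yEven (conj ν) (conj x) := by
  rw [yEven, yEven, map_mul, Complex.conj_tsum, ← Complex.exp_conj]
  simp [evenCoeff, Complex.conj_ofNat]

theorem conj_yOdd (ν x : ℂ) : conj (yOdd ν x) = yOdd (conj ν) (conj x) := by
  rw [yOdd, yOdd, map_mul, Complex.conj_tsum, ← Complex.exp_conj]
  simp [oddCoeff, Complex.conj_ofNat]

theorem conj_dValue (ν : ℂ) : conj (dValue ν) = dValue (conj ν) := by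
  have hpow : conj ((2 : ℂ) ^ (ν / 2)) = 2 ^ conj (ν / 2) := by
    rw [Complex.cpow_conj _ _ (by simp [Real.pi_ne_zero.symm]), Complex.conj_ofNat]
  simp [dValue, hpow, Complex.conj_ofNat, ← Complex.Gamma_conj]

theorem conj_dSlope (ν : ℂ) : conj (dSlope ν) = dSlope (conj ν) := by
  rw [dSlope_eq_mul_dValue, dSlope_eq_mul_dValue, map_mul, conj_dValue, map_sub, map_one]

theorem conj_parabolicD (ν x : ℂ) : conj (parabolicD ν x) = parabolicD (conj ν) (conj x) := by
  simp only [parabolicD, map_add, map_mul, conj_yEven, conj_yOdd, conj_dValue, conj_dSlope]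

/-! ### Integral representation -/

/-- The Mellin transform at `s` of `exp (-t ^ 2 / 2)`, in closed form; it normalizes the initial
data of `D_ν` at the origin. -/
noncomputable def gaussMoment (s : ℂ) : ℂ := 2 ^ (s / 2 - 1) * Gamma (s / 2)

theorem gaussMoment_add_two {s : ℂ} (hs : s ≠ 0) : gaussMoment (s + 2) = s * gaussMoment s := by
  rw [gaussMoment, gaussMoment, show (s + 2) / 2 = s / 2 + 1 by ring,
    Complex.Gamma_add_one _ (div_ne_zero hs two_ne_zero), add_sub_cancel_right,
    Complex.cpow_sub _ _ two_ne_zero, Complex.cpow_one]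
  ring

theorem gaussMoment_add_two_mul {s : ℂ} (hs : 0 < s.re) (k : ℕ) :
    gaussMoment (s + 2 * k) = gaussMoment s * ∏ j ∈ Finset.range k, (s + 2 * (j : ℂ)) := by
  induction k with
  | zero => simp
  | succ k ih =>
    have hne : s + 2 * k ≠ 0 := fun h => by
      have hre := congrArg Complex.re h
      simp only [Complex.add_re, Complex.mul_re, Complex.re_ofNat, Complex.natCast_re,
        Complex.im_ofNat, Complex.natCast_im, mul_zero, sub_zero, Complex.zero_re] at hre
      linarith [(k.cast_nonneg : (0 : ℝ) ≤ k)]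
    rw [Finset.prod_range_succ, ← mul_assoc, ← ih, Nat.cast_succ, mul_add_one, ← add_assoc,
      gaussMoment_add_two hne, mul_comm]

theorem Gamma_mul_dValue {ν : ℂ} (hν : Gamma (-ν / 2 + 1 / 2) ≠ 0) :
    Gamma (-ν) * dValue ν = gaussMoment (-ν) := by
  have hdup := Complex.Gamma_mul_Gamma_add_half (-ν / 2)
  rw [show 2 * (-ν / 2) = -ν by ring] at hdup
  have hpow : (2 : ℂ) ^ (ν / 2) = 2 ^ (-ν / 2 - 1) * 2 ^ (1 - -ν) := by
    rw [← Complex.cpow_add _ _ two_ne_zero]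
    ring_nf
  rw [dValue, gaussMoment, hpow, ← mul_assoc, mul_inv_eq_iff_eq_mul₀ hν]
  linear_combination -2 ^ (-ν / 2 - 1) * hdup

theorem Gamma_mul_dSlope {ν : ℂ} (hν : Gamma (-ν / 2) ≠ 0) :
    Gamma (-ν) * dSlope ν = -gaussMoment (1 - ν) := by
  have hdup := Complex.Gamma_mul_Gamma_add_half (-ν / 2)
  rw [show 2 * (-ν / 2) = -ν by ring, show -ν / 2 + 1 / 2 = (1 - ν) / 2 by ring] at hdup
  have hpow : (2 : ℂ) ^ ((ν + 1) / 2) = 2 ^ ((1 - ν) / 2 - 1) * 2 ^ (1 - -ν) := by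
    rw [← Complex.cpow_add _ _ two_ne_zero]
    ring_nf
  rw [dSlope, gaussMoment, hpow, mul_neg, neg_inj, ← mul_assoc, mul_inv_eq_iff_eq_mul₀ hν]
  linear_combination -2 ^ ((1 - ν) / 2 - 1) * hdup

theorem norm_mellin_le_of_norm_le {E : Type*} [NormedAddCommGroup E] [NormedSpace ℂ E]
    {f : ℝ → E} {g : ℝ → ℝ} {s : ℂ} (hg : MellinConvergent (fun t => (g t : ℂ)) s.re)
    (hfg : ∀ t > 0, ‖f t‖ ≤ g t) : ‖mellin f s‖ ≤ ‖mellin (fun t => (g t : ℂ)) s.re‖ := by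
  have hint (t : ℝ) (ht : t ∈ Ioi (0 : ℝ)) :
      (t : ℂ) ^ ((s.re : ℂ) - 1) • (g t : ℂ) = ((t ^ (s.re - 1) * g t : ℝ) : ℂ) := by
    rw [smul_eq_mul, Complex.ofReal_mul, Complex.ofReal_cpow (le_of_lt ht)]
    push_cast
    rfl
  have hint' : IntegrableOn (fun t => t ^ (s.re - 1) * g t) (Ioi 0) :=
    ((integrableOn_congr_fun hint measurableSet_Ioi).1 hg).re
  rw [mellin, mellin, setIntegral_congr_fun measurableSet_Ioi hint, integral_complex_ofReal,
    Complex.norm_real]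
  refine (norm_integral_le_of_norm_le hint' ?_).trans (le_abs_self _)
  refine (ae_restrict_iff' measurableSet_Ioi).2 (.of_forall fun t ht => ?_)
  rw [norm_smul, Complex.norm_cpow_eq_rpow_re_of_pos ht, Complex.sub_re, Complex.one_re]
  exact mul_le_mul_of_nonneg_left (hfg t ht) (Real.rpow_nonneg (le_of_lt ht) _)

theorem hasSum_integral_pow_div_factorial_smul {α E : Type*} [MeasurableSpace α] {μ : Measure α}
    [NormedAddCommGroup E] [NormedSpace ℂ E] {u : α → ℂ} {h : α → E}
    (hu : AEStronglyMeasurable u μ) (hint : Integrable (fun a => Real.exp ‖u a‖ • h a) μ) :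
    HasSum (fun n : ℕ => ∫ a, (u a ^ n / n.factorial) • h a ∂μ)
      (∫ a, Complex.exp (u a) • h a ∂μ) := by
  have hmeas : AEStronglyMeasurable h μ := by
    have hexp := (Real.continuous_exp.comp_aestronglyMeasurable hu.norm.neg).smul
      hint.aestronglyMeasurable
    refine hexp.congr (.of_forall fun a => ?_)
    simp [smul_smul, ← Real.exp_add]
  refine hasSum_integral_of_dominated_convergence
    (fun n a => ‖u a‖ ^ n / n.factorial * ‖h a‖) (fun n => ?_) (fun n => .of_forall fun a => ?_)
    (.of_forall fun a => (Real.summable_pow_div_factorial _).mul_right _) ?_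
    (.of_forall fun a => ?_)
  · simp only [div_eq_inv_mul]
    exact ((hu.pow n).const_mul _).smul hmeas
  · rw [norm_smul, norm_div, norm_pow, Complex.norm_natCast]
  · refine hint.norm.congr (.of_forall fun a => ?_)
    beta_reduce
    rw [tsum_mul_right, (NormedSpace.expSeries_div_hasSum_exp ‖u a‖).tsum_eq, norm_smul,
      ← Real.exp_eq_exp_ℝ, Real.norm_of_nonneg (Real.exp_pos _).le]
  · rw [Complex.exp_eq_exp_ℂ]
    exact (NormedSpace.expSeries_div_hasSum_exp (u a)).smul_const _

theorem hasSum_mellin_cexp_smul {E : Type*} [NormedAddCommGroup E] [NormedSpace ℂ E]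
    {g : ℝ → E} {s x : ℂ} (hg : MellinConvergent (fun t => Real.exp (‖x‖ * t) • g t) s) :
    HasSum (fun n : ℕ => ((-x) ^ n / n.factorial) • mellin g (s + n))
      (mellin (fun t => Complex.exp (-x * t) • g t) s) := by
  have hint : IntegrableOn (fun t : ℝ => Real.exp ‖-x * t‖ • (t : ℂ) ^ (s - 1) • g t) (Ioi 0) := by
    refine hg.congr_fun (fun t ht => ?_) measurableSet_Ioi
    rw [norm_mul, norm_neg, Complex.norm_of_nonneg (le_of_lt ht), smul_comm]
  have hsum := hasSum_integral_pow_div_factorial_smul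
    (Continuous.aestronglyMeasurable (by fun_prop)) hint
  rw [mellin, integral_congr_ae (.of_forall fun t => smul_comm _ _ _)]
  refine hsum.congr_fun fun n => ?_
  rw [← mellin_cpow_smul, mellin, ← integral_smul]
  refine setIntegral_congr_fun measurableSet_Ioi fun t _ => ?_
  simp only [Complex.cpow_natCast, smul_smul]
  ring_nf

theorem mellin_exp_neg_sq_div_two {s : ℂ} (hs : 0 < s.re) :
    mellin (fun t : ℝ => (Real.exp (-t ^ 2 / 2) : ℂ)) s = gaussMoment s := by
  have hGamma : Gamma (s / 2) = mellin (fun t : ℝ => (Real.exp (-t) : ℂ)) (s / 2) := by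
    rw [← Complex.GammaIntegral_eq_mellin, Complex.Gamma_eq_integral]
    simpa using hs
  have hfun : (fun t : ℝ => (Real.exp (-t ^ 2 / 2) : ℂ)) =
      fun t : ℝ => (Real.exp (-(2⁻¹ * t ^ (2 : ℝ))) : ℂ) := by
    funext t
    rw [Real.rpow_two]
    ring_nf
  have hpow : (((2⁻¹ : ℝ) : ℂ)) ^ (-(s / 2)) = 2 ^ (s / 2) := by
    rw [Complex.ofReal_inv, Complex.ofReal_ofNat, Complex.cpow_neg, Complex.inv_cpow _ _ ?_,
      inv_inv]
    simp [Real.pi_ne_zero.symm]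
  rw [hfun, mellin_comp_rpow (fun u : ℝ => (Real.exp (-(2⁻¹ * u)) : ℂ)),
    mellin_comp_mul_left (fun u : ℝ => (Real.exp (-u) : ℂ)) _ (by norm_num : (0 : ℝ) < 2⁻¹),
    Complex.ofReal_ofNat, hpow, ← hGamma, gaussMoment, Complex.cpow_sub _ _ two_ne_zero,
    Complex.cpow_one, abs_two, Complex.real_smul, smul_eq_mul, Complex.ofReal_inv,
    Complex.ofReal_ofNat]
  ring

/-- The kernel `exp (-x t - t ^ 2 / 2)`, whose Mellin transform in `t` represents the parabolic
cylinder function of order `-s`. -/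
noncomputable def cylinderKernel (x : ℂ) (t : ℝ) : ℂ :=
  Complex.exp (-x * t) * (Real.exp (-t ^ 2 / 2) : ℂ)

theorem continuous_cylinderKernel (x : ℂ) : Continuous (cylinderKernel x) := by
  unfold cylinderKernel
  fun_prop

theorem norm_cylinderKernel (x : ℂ) (t : ℝ) :
    ‖cylinderKernel x t‖ = Real.exp (-x.re * t) * Real.exp (-t ^ 2 / 2) := by
  rw [cylinderKernel, norm_mul, Complex.norm_exp, Complex.re_mul_ofReal, Complex.neg_re,
    Complex.norm_of_nonneg (Real.exp_pos _).le]

theorem cylinderKernel_ofReal (b t : ℝ) :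
    cylinderKernel b t = ((Real.exp (-b * t) * Real.exp (-t ^ 2 / 2) : ℝ) : ℂ) := by
  rw [cylinderKernel]
  push_cast
  rfl

theorem isBigO_cylinderKernel_atTop (x : ℂ) :
    cylinderKernel x =O[atTop] fun t => Real.exp (-1 * t) := by
  refine .of_bound (Real.exp ((1 - x.re) ^ 2 / 2)) (.of_forall fun t => ?_)
  rw [norm_cylinderKernel, Real.norm_of_nonneg (Real.exp_pos _).le, ← Real.exp_add,
    ← Real.exp_add, Real.exp_le_exp]
  nlinarith [sq_nonneg (t - (1 - x.re))]

theorem isBigO_cylinderKernel_nhdsGT_zero (x : ℂ) :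
    cylinderKernel x =O[𝓝[>] 0] fun t : ℝ => t ^ (-0 : ℝ) := by
  simpa only [neg_zero, Real.rpow_zero] using
    ((continuous_cylinderKernel x).tendsto 0).isBigO_one ℝ |>.mono nhdsWithin_le_nhds

theorem mellinConvergent_cylinderKernel (x : ℂ) {s : ℂ} (hs : 0 < s.re) :
    MellinConvergent (cylinderKernel x) s :=
  mellinConvergent_of_isBigO_rpow_exp one_pos
    ((continuous_cylinderKernel x).locallyIntegrable.locallyIntegrableOn _)
    (isBigO_cylinderKernel_atTop x) (isBigO_cylinderKernel_nhdsGT_zero x) hs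

theorem differentiableAt_mellin_cylinderKernel (x : ℂ) {s : ℂ} (hs : 0 < s.re) :
    DifferentiableAt ℂ (mellin (cylinderKernel x)) s :=
  mellin_differentiableAt_of_isBigO_rpow_exp one_pos
    ((continuous_cylinderKernel x).locallyIntegrable.locallyIntegrableOn _)
    (isBigO_cylinderKernel_atTop x) (isBigO_cylinderKernel_nhdsGT_zero x) hs

theorem hasSum_mellin_cylinderKernel (x : ℂ) {s : ℂ} (hs : 0 < s.re) :
    HasSum (fun n : ℕ => (-x) ^ n / n.factorial * gaussMoment (s + n))
      (mellin (cylinderKernel x) s) := by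
  have hfun : cylinderKernel (-‖x‖ : ℝ) =
      fun t => Real.exp (‖x‖ * t) • (Real.exp (-t ^ 2 / 2) : ℂ) := by
    funext t
    rw [cylinderKernel_ofReal, neg_neg, Complex.ofReal_mul, Complex.real_smul]
  have hconv := mellinConvergent_cylinderKernel (-‖x‖ : ℝ) hs
  rw [hfun] at hconv
  refine (hasSum_mellin_cexp_smul hconv).congr_fun fun n => ?_
  have hsn : 0 < (s + n).re := by
    rw [Complex.add_re, Complex.natCast_re]
    exact add_pos_of_pos_of_nonneg hs n.cast_nonneg
  rw [smul_eq_mul, mellin_exp_neg_sq_div_two hsn]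

theorem Gamma_mul_parabolicD {ν : ℂ} (hν : ν.re < 0) (x : ℂ) :
    Gamma (-ν) * parabolicD ν x =
      Complex.exp (-x ^ 2 / 4) * mellin (cylinderKernel x) (-ν) := by
  have hs : 0 < (-ν).re := by rwa [Complex.neg_re, neg_pos]
  have hs' : 0 < (1 - ν).re := by rw [Complex.sub_re, Complex.one_re]; linarith
  have heven (k : ℕ) : (-x) ^ (2 * k) / (2 * k).factorial * gaussMoment (-ν + (2 * k : ℕ)) =
      gaussMoment (-ν) * (evenCoeff ν k * x ^ (2 * k)) := by
    have hmoment := gaussMoment_add_two_mul hs k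
    rw [evenCoeff, (even_two_mul k).neg_pow]
    push_cast
    rw [hmoment]
    ring
  have hodd (k : ℕ) :
      (-x) ^ (2 * k + 1) / (2 * k + 1).factorial * gaussMoment (-ν + (2 * k + 1 : ℕ)) =
        -gaussMoment (1 - ν) * (oddCoeff ν k * x ^ (2 * k + 1)) := by
    have hmoment := gaussMoment_add_two_mul hs' k
    rw [oddCoeff, (odd_two_mul_add_one k).neg_pow,
      show -ν + (2 * k + 1 : ℕ) = 1 - ν + 2 * k by push_cast; ring, hmoment, neg_add_eq_sub ν 1]
    ring
  have hsum := HasSum.even_add_odd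
    (f := fun n : ℕ => (-x) ^ n / n.factorial * gaussMoment (-ν + n))
    (((summable_evenCoeff ν x).hasSum.mul_left _).congr_fun heven)
    (((summable_oddCoeff ν x).hasSum.mul_left _).congr_fun hodd)
  have hGamma : Gamma (-ν / 2) ≠ 0 := Complex.Gamma_ne_zero_of_re_pos (by simpa using hν)
  have hGamma' : Gamma (-ν / 2 + 1 / 2) ≠ 0 := Complex.Gamma_ne_zero_of_re_pos (by
    simp
    linarith)
  rw [(hasSum_mellin_cylinderKernel x hs).unique hsum, ← Gamma_mul_dValue hGamma',
    ← Gamma_mul_dSlope hGamma, parabolicD, yEven, yOdd]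
  ring

/-! ### Decay at infinity -/

theorem norm_parabolicD_le {ν : ℂ} (hν : ν.re < 0) {b x : ℝ} (hx : b ≤ x) :
    ‖parabolicD ν x‖ ≤
      ‖(Gamma (-ν))⁻¹ * mellin (cylinderKernel b) (-ν.re : ℝ)‖ * Real.exp (-x ^ 2 / 4) := by
  have hs : 0 < (-ν).re := by rwa [Complex.neg_re, neg_pos]
  have hmellin : ‖mellin (cylinderKernel x) (-ν)‖ ≤ ‖mellin (cylinderKernel b) (-ν.re : ℝ)‖ := by
    rw [← Complex.neg_re, funext (cylinderKernel_ofReal b)]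
    refine norm_mellin_le_of_norm_le ?_ fun t ht => ?_
    · rw [← funext (cylinderKernel_ofReal b)]
      exact mellinConvergent_cylinderKernel b (by rwa [Complex.ofReal_re])
    · rw [norm_cylinderKernel, Complex.ofReal_re]
      gcongr
  have hrep := Gamma_mul_parabolicD hν x
  rw [← eq_inv_mul_iff_mul_eq₀ (Complex.Gamma_ne_zero_of_re_pos hs)] at hrep
  have hexp : ‖Complex.exp (-x ^ 2 / 4)‖ = Real.exp (-x ^ 2 / 4) := by
    rw [← Complex.norm_of_nonneg (Real.exp_pos (-x ^ 2 / 4)).le]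
    push_cast
    rfl
  rw [hrep, norm_mul, norm_mul, norm_mul, hexp, mul_assoc, mul_comm (Real.exp _)]
  gcongr

theorem isBigO_parabolicD_of_re_neg (b c : ℝ) {ν₀ : ℂ} (hν₀ : ν₀.re < 0) :
    (fun p : ℂ × ℝ => parabolicD p.1 p.2) =O[𝓝 ν₀ ×ˢ 𝓟 (Ici b)]
      fun p => Real.exp (-c * |p.2|) := by
  have hcont : ContinuousAt
      (fun ν : ℂ => (Gamma (-ν))⁻¹ * mellin (cylinderKernel b) (-ν.re : ℝ)) ν₀ := by
    refine ContinuousAt.mul (Complex.differentiable_one_div_Gamma.comp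
      differentiable_neg).continuous.continuousAt (ContinuousAt.comp (g := mellin _)
      (f := fun ν : ℂ => ((-ν.re : ℝ) : ℂ)) ?_ (by fun_prop))
    exact (differentiableAt_mellin_cylinderKernel b (by simpa using hν₀)).continuousAt
  have hfactor := (hcont.tendsto.isBigO_one ℝ).comp_tendsto (tendsto_fst (g := 𝓟 (Ici b)))
  have hgauss : (fun p : ℂ × ℝ => Real.exp (-p.2 ^ 2 / 4)) =O[𝓝 ν₀ ×ˢ 𝓟 (Ici b)]
      fun p => Real.exp (-c * |p.2|) := by
    refine .of_bound (Real.exp (c ^ 2)) (.of_forall fun p => ?_)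
    rw [Real.norm_of_nonneg (Real.exp_pos _).le, Real.norm_of_nonneg (Real.exp_pos _).le,
      ← Real.exp_add, Real.exp_le_exp, ← sq_abs p.2]
    nlinarith [sq_nonneg (|p.2| / 2 - c)]
  refine (IsBigO.of_bound' ?_).trans ((hfactor.norm_left.mul hgauss).congr_right fun _ =>
    one_mul _)
  filter_upwards [prod_mem_prod (Complex.continuous_re.continuousAt.eventually_lt_const hν₀)
    (mem_principal_self _)] with p hp
  refine (norm_parabolicD_le hp.1 hp.2).trans (le_of_eq ?_)
  rw [Real.norm_of_nonneg (by positivity), Function.comp_apply]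

theorem isBigO_parabolicD_of_re_lt (b : ℝ) (n : ℕ) : ∀ (c : ℝ) (ν₀ : ℂ), ν₀.re < n →
    (fun p : ℂ × ℝ => parabolicD p.1 p.2) =O[𝓝 ν₀ ×ˢ 𝓟 (Ici b)]
      fun p => Real.exp (-c * |p.2|) := by
  induction n with
  | zero => exact fun c ν₀ hν₀ => isBigO_parabolicD_of_re_neg b c (by simpa using hν₀)
  | succ n ih =>
    intro c ν₀ hν₀
    rw [Nat.cast_succ] at hν₀
    have hshift (a : ℂ) : Tendsto (fun p : ℂ × ℝ => (p.1 - a, p.2)) (𝓝 ν₀ ×ˢ 𝓟 (Ici b))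
        (𝓝 (ν₀ - a) ×ˢ 𝓟 (Ici b)) :=
      ((continuous_sub_right a).tendsto ν₀).prodMap tendsto_id
    have hone := (ih (c + 1) (ν₀ - 1) (by simp; linarith)).comp_tendsto (hshift 1)
    have htwo := (ih c (ν₀ - 2) (by simp; linarith)).comp_tendsto (hshift 2)
    have hx : (fun p : ℂ × ℝ => (p.2 : ℂ)) =O[𝓝 ν₀ ×ˢ 𝓟 (Ici b)] fun p => Real.exp |p.2| := by
      refine .of_bound' (.of_forall fun p => ?_)
      rw [Complex.norm_real, Real.norm_eq_abs, Real.norm_of_nonneg (Real.exp_pos _).le]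
      linarith [Real.add_one_le_exp |p.2|]
    have hν : (fun p : ℂ × ℝ => p.1 - 1) =O[𝓝 ν₀ ×ˢ 𝓟 (Ici b)] fun _ => (1 : ℝ) :=
      ((continuous_sub_right 1).tendsto ν₀ |>.isBigO_one ℝ).comp_tendsto tendsto_fst
    rw [show (fun p : ℂ × ℝ => parabolicD p.1 p.2) =
      fun p => p.2 * parabolicD (p.1 - 1) p.2 - (p.1 - 1) * parabolicD (p.1 - 2) p.2 from
      funext fun p => parabolicD_eq_sub _ _]
    refine ((hx.mul hone).congr_right fun p => ?_).sub
      ((hν.mul htwo).congr_right fun p => one_mul _)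
    rw [Function.comp_apply, ← Real.exp_add]
    ring_nf

theorem isBigO_parabolicD (b : ℝ) (ν₀ : ℂ) :
    (fun p : ℂ × ℝ => parabolicD p.1 p.2) =O[𝓝 ν₀ ×ˢ 𝓟 (Ici b)] fun p => Real.exp (-|p.2|) := by
  obtain ⟨n, hn⟩ := exists_nat_gt ν₀.re
  simpa only [neg_one_mul] using isBigO_parabolicD_of_re_lt b n 1 ν₀ hn

/-! ### Integration by parts -/

theorem continuous_parabolicD (ν : ℂ) : Continuous fun x : ℝ => parabolicD ν x :=
  (continuous_iff_continuousAt.2 fun x => (hasDerivAt_parabolicD ν x).continuousAt).comp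
    Complex.continuous_ofReal

theorem eventually_norm_parabolicD_mul_le (b : ℝ) (μ ν₀ : ℂ) :
    ∃ C : ℝ, ∀ᶠ ν in 𝓝 ν₀, ∀ x ∈ Ici b,
      ‖parabolicD μ x * parabolicD ν x‖ ≤ C * Real.exp (-x) := by
  have hμ : (fun p : ℂ × ℝ => parabolicD μ p.2) =O[𝓝 ν₀ ×ˢ 𝓟 (Ici b)]
      fun p => Real.exp (-|p.2|) :=
    (isBigO_parabolicD b μ).comp_tendsto
      (k := fun p : ℂ × ℝ => (μ, p.2)) (tendsto_const_nhds.prodMk tendsto_snd)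
  have hexp : (fun p : ℂ × ℝ => Real.exp (-|p.2|) * Real.exp (-|p.2|))
      =O[𝓝 ν₀ ×ˢ 𝓟 (Ici b)] fun p => Real.exp (-p.2) := by
    refine .of_bound' (.of_forall fun p => ?_)
    rw [← Real.exp_add, Real.norm_of_nonneg (Real.exp_pos _).le,
      Real.norm_of_nonneg (Real.exp_pos _).le, Real.exp_le_exp]
    linarith [le_abs_self p.2, abs_nonneg p.2]
  obtain ⟨C, hC⟩ := ((hμ.mul (isBigO_parabolicD b ν₀)).trans hexp).bound
  refine ⟨C, (eventually_prod_principal_iff.1 hC).mono fun ν hν x hx => ?_⟩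
  simpa only [Real.norm_of_nonneg (Real.exp_pos _).le] using hν x hx

theorem integrableOn_parabolicD_mul (μ ν : ℂ) (b : ℝ) :
    IntegrableOn (fun x : ℝ => parabolicD μ x * parabolicD ν x) (Ioi b) := by
  obtain ⟨C, hC⟩ := eventually_norm_parabolicD_mul_le b μ ν
  exact ((integrableOn_exp_neg_Ioi b).const_mul C).mono'
    ((continuous_parabolicD μ).mul (continuous_parabolicD ν)).aestronglyMeasurable
    (ae_restrict_of_forall_mem measurableSet_Ioi fun x hx =>
      hC.self_of_nhds x (Ioi_subset_Ici_self hx))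

theorem tendsto_parabolicD_mul_atTop (μ ν : ℂ) :
    Tendsto (fun x : ℝ => parabolicD μ x * parabolicD ν x) atTop (𝓝 0) := by
  obtain ⟨C, hC⟩ := eventually_norm_parabolicD_mul_le 0 μ ν
  refine squeeze_zero_norm' ((eventually_ge_atTop 0).mono hC.self_of_nhds) ?_
  simpa using Real.tendsto_exp_neg_atTop_nhds_zero.const_mul C

/-- The bilinear pairing `∫_b^∞ D_μ(x) D_ν(x) dx`; no complex conjugate is taken, so that the
ladder relations apply to both factors. -/
noncomputable def pairing (b : ℝ) (μ ν : ℂ) : ℂ :=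
  ∫ x in Ioi b, parabolicD μ (x : ℝ) * parabolicD ν (x : ℝ)

theorem pairing_comm (b : ℝ) (μ ν : ℂ) : pairing b μ ν = pairing b ν μ := by
  simp only [pairing, mul_comm]

theorem continuous_pairing (b : ℝ) (μ : ℂ) : Continuous (pairing b μ) := by
  refine continuous_iff_continuousAt.2 fun ν₀ => ?_
  obtain ⟨C, hC⟩ := eventually_norm_parabolicD_mul_le b μ ν₀
  refine tendsto_integral_filter_of_dominated_convergence (fun x => C * Real.exp (-x))
    (.of_forall fun ν =>
      ((continuous_parabolicD μ).mul (continuous_parabolicD ν)).aestronglyMeasurable)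
    (hC.mono fun ν hν =>
      ae_restrict_of_forall_mem measurableSet_Ioi fun x hx => hν x (Ioi_subset_Ici_self hx))
    ((integrableOn_exp_neg_Ioi b).const_mul C)
    (.of_forall fun x =>
      ((differentiable_parabolicD_left x).continuous.const_mul _).tendsto ν₀)

theorem mul_pairing_sub_pairing (b : ℝ) (μ ν : ℂ) :
    μ * pairing b (μ - 1) ν - pairing b μ (ν + 1) = -(parabolicD μ b * parabolicD ν b) := by
  have hleft := (integrableOn_parabolicD_mul (μ - 1) ν b).const_mul μ
  have hright := integrableOn_parabolicD_mul μ (ν + 1) b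
  rw [pairing, pairing, ← integral_const_mul, ← integral_sub hleft hright, ← zero_sub]
  refine integral_Ioi_of_hasDerivAt_of_tendsto' (fun x _ => ?_) (hleft.sub hright)
    (tendsto_parabolicD_mul_atTop μ ν)
  refine ((hasDerivAt_parabolicD μ x).comp_ofReal.mul
    (hasDerivAt_parabolicD' ν x).comp_ofReal).congr_deriv ?_
  simp only [Pi.sub_apply]
  ring

theorem sub_mul_pairing (b : ℝ) (μ ν : ℂ) :
    (μ - ν) * pairing b μ ν =
      parabolicD (ν + 1) b * parabolicD μ b - parabolicD (μ + 1) b * parabolicD ν b := by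
  have hμ := mul_pairing_sub_pairing b (μ + 1) ν
  have hν := mul_pairing_sub_pairing b (ν + 1) μ
  rw [add_sub_cancel_right] at hμ hν
  rw [pairing_comm b ν μ, pairing_comm b (ν + 1)] at hν
  linear_combination hμ - hν

/-- The squared `L²` norm of `D_ν` on `(b, ∞)`. -/
noncomputable def normSqD (b : ℝ) (ν : ℂ) : ℝ := ∫ x in Ioi b, ‖parabolicD ν (x : ℝ)‖ ^ 2

theorem normSqD_nonneg (b : ℝ) (ν : ℂ) : 0 ≤ normSqD b ν :=
  integral_nonneg fun _ => sq_nonneg _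

theorem conj_parabolicD_ofReal (ν : ℂ) (x : ℝ) :
    conj (parabolicD ν x) = parabolicD (conj ν) x := by
  rw [conj_parabolicD, Complex.conj_ofReal]

theorem parabolicD_conj_mul_self (ν : ℂ) (x : ℝ) :
    parabolicD (conj ν) x * parabolicD ν x = ((‖parabolicD ν x‖ ^ 2 : ℝ) : ℂ) := by
  rw [← conj_parabolicD_ofReal, Complex.conj_mul', Complex.ofReal_pow]

theorem pairing_conj_self (b : ℝ) (ν : ℂ) : pairing b (conj ν) ν = normSqD b ν := by
  simp only [pairing, normSqD, ← integral_complex_ofReal, parabolicD_conj_mul_self]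

theorem normSqD_pos {b : ℝ} {ν : ℂ} (h : parabolicD ν b ≠ 0) : 0 < normSqD b ν := by
  have hcont : Continuous fun x : ℝ => ‖parabolicD ν x‖ ^ 2 :=
    (continuous_parabolicD ν).norm.pow 2
  have hint : IntegrableOn (fun x : ℝ => ‖parabolicD ν x‖ ^ 2) (Ioi b) := by
    simpa only [IntegrableOn, norm_mul, ← conj_parabolicD_ofReal, RCLike.norm_conj, ← sq] using
      (integrableOn_parabolicD_mul (conj ν) ν b).norm
  rw [normSqD, setIntegral_pos_iff_support_of_nonneg_ae (.of_forall fun _ => sq_nonneg _) hint]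
  refine (hcont.isOpen_support.inter isOpen_Ioi).measure_pos volume ?_
  have hsupp : Function.support (fun x : ℝ => ‖parabolicD ν x‖ ^ 2) ∈ 𝓝[>] b :=
    mem_nhdsWithin_of_mem_nhds (hcont.isOpen_support.mem_nhds (by simpa using h))
  exact nonempty_of_mem (inter_mem hsupp self_mem_nhdsWithin)

theorem conj_mul_normSqD_sub_one {b : ℝ} {l : ℂ} (h : parabolicD l b = 0) :
    conj l * normSqD b (l - 1) = normSqD b l := by
  have hparts := mul_pairing_sub_pairing b (conj l) (l - 1)
  rw [← conj_parabolicD_ofReal, h, map_zero, sub_add_cancel, zero_mul, neg_zero,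
    pairing_conj_self, show conj l - 1 = conj (l - 1) by simp, pairing_conj_self] at hparts
  exact sub_eq_zero.1 hparts

theorem im_eq_zero_and_re_pos_of_parabolicD_eq_zero {b : ℝ} {l : ℂ} (h : parabolicD l b = 0) :
    l.im = 0 ∧ 0 < l.re := by
  obtain ⟨hl, hsub⟩ := mul_ne_zero_iff.1 (mul_parabolicD_sub_one_ne_zero h)
  have hpos := normSqD_pos hsub
  have heq := conj_mul_normSqD_sub_one h
  have hre : l.re * normSqD b (l - 1) = normSqD b l := by simpa using congrArg Complex.re heq
  have him : l.im = 0 := by simpa [hpos.ne'] using congrArg Complex.im heq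
  refine ⟨him, lt_of_le_of_ne ?_ fun hzero => hl (Complex.ext hzero.symm him)⟩
  exact nonneg_of_mul_nonneg_left (hre ▸ normSqD_nonneg b l) hpos

theorem normSqD_ne_zero_of_parabolicD_eq_zero {b : ℝ} {l : ℂ} (h : parabolicD l b = 0) :
    normSqD b l ≠ 0 := by
  obtain ⟨hl, hsub⟩ := mul_ne_zero_iff.1 (mul_parabolicD_sub_one_ne_zero h)
  rw [← Complex.ofReal_ne_zero, ← conj_mul_normSqD_sub_one h]
  exact mul_ne_zero ((map_ne_zero _).2 hl) (Complex.ofReal_ne_zero.2 (normSqD_pos hsub).ne')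

theorem parabolicD_add_one_mul_deriv {b : ℝ} {l : ℂ} (h : parabolicD l b = 0) :
    parabolicD (l + 1) b * deriv (fun ν => parabolicD ν b) l = pairing b l l := by
  have hslope := (differentiable_parabolicD_left b l).hasDerivAt.tendsto_slope.const_mul
    (parabolicD (l + 1) b)
  have hpairing : Tendsto (pairing b l) (𝓝[≠] l) (𝓝 (pairing b l l)) :=
    (continuous_pairing b l).continuousAt.mono_left nhdsWithin_le_nhds
  refine tendsto_nhds_unique (hslope.congr' ?_) hpairing
  filter_upwards [self_mem_nhdsWithin] with ν hν
  have hwronskian := sub_mul_pairing b l ν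
  rw [h] at hwronskian
  rw [slope_def_field, h, sub_zero, mul_div_assoc', div_eq_iff (sub_ne_zero.2 hν)]
  linear_combination hwronskian

theorem conj_eq_self_of_parabolicD_eq_zero {b : ℝ} {l : ℂ} (h : parabolicD l b = 0) :
    conj l = l :=
  Complex.conj_eq_iff_im.2 (im_eq_zero_and_re_pos_of_parabolicD_eq_zero h).1

theorem deriv_parabolicD_ne_zero {b : ℝ} {l : ℂ} (h : parabolicD l b = 0) :
    deriv (fun ν => parabolicD ν b) l ≠ 0 := by
  have hnorm := pairing_conj_self b l
  rw [conj_eq_self_of_parabolicD_eq_zero h, ← parabolicD_add_one_mul_deriv h] at hnorm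
  refine right_ne_zero_of_mul (a := parabolicD (l + 1) b) ?_
  rw [hnorm]
  exact Complex.ofReal_ne_zero.2 (normSqD_ne_zero_of_parabolicD_eq_zero h)

theorem analyticOrderAt_parabolicD_eq_one {b : ℝ} {l : ℂ} (h : parabolicD l b = 0) :
    analyticOrderAt (fun ν => parabolicD ν b) l = 1 :=
  ((differentiable_parabolicD_left b).analyticAt l).analyticOrderAt_eq_one_of_zero_deriv_ne_zero h
    (deriv_parabolicD_ne_zero h)

/-! ### The leading coefficient of `M` -/

theorem Gamma_neg_ne_zero {ν : ℂ} (hν : ∀ n : ℕ, ν ≠ n) : Gamma (-ν) ≠ 0 :=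
  Complex.Gamma_ne_zero fun n hn => hν n (neg_injective hn)

theorem Gamma_neg_half_ne_zero {ν : ℂ} (hν : ∀ n : ℕ, ν ≠ n) : Gamma (-ν / 2) ≠ 0 :=
  Complex.Gamma_ne_zero fun n hn => hν (2 * n) <| by
    push_cast
    linear_combination -2 * hn

theorem Gamma_neg_half_add_half_ne_zero {ν : ℂ} (hν : ∀ n : ℕ, ν ≠ n) :
    Gamma (-ν / 2 + 1 / 2) ≠ 0 :=
  Complex.Gamma_ne_zero fun n hn => hν (2 * n + 1) <| by
    push_cast
    linear_combination -2 * hn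

theorem sqrt_two_div_pi_mul_Gamma_mul_dValue_mul_dSlope {ν : ℂ} (hν : ∀ n : ℕ, ν ≠ n) :
    (Real.sqrt (2 / Real.pi) : ℂ) * Gamma (-ν) * dValue ν * dSlope ν = -1 := by
  have hpow : (2 : ℂ) ^ (ν / 2) * 2 ^ ((1 - ν) / 2 - 1) = (2 ^ (1 / 2 : ℂ))⁻¹ := by
    rw [← Complex.cpow_add _ _ two_ne_zero, ← Complex.cpow_neg]
    ring_nf
  have hsqrt : (Real.sqrt 2 : ℂ) = 2 ^ (1 / 2 : ℂ) := by
    rw [Real.sqrt_eq_rpow, Complex.ofReal_cpow zero_le_two]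
    push_cast
    rfl
  have hvalue : dValue ν * gaussMoment (1 - ν) = (2 ^ (1 / 2 : ℂ))⁻¹ * Real.sqrt Real.pi := by
    have hΓ := Gamma_neg_half_add_half_ne_zero hν
    rw [show -ν / 2 + 1 / 2 = (1 - ν) / 2 by ring] at hΓ
    rw [dValue, gaussMoment, ← hpow, show -ν / 2 + 1 / 2 = (1 - ν) / 2 by ring]
    field_simp
  have h2 := two_cpow_ne_zero (1 / 2)
  have hπ := sqrt_pi_ne_zero
  calc (Real.sqrt (2 / Real.pi) : ℂ) * Gamma (-ν) * dValue ν * dSlope ν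
      = Real.sqrt (2 / Real.pi) * (dValue ν * (Gamma (-ν) * dSlope ν)) := by ring
    _ = -(2 ^ (1 / 2 : ℂ) / Real.sqrt Real.pi *
          ((2 ^ (1 / 2 : ℂ))⁻¹ * Real.sqrt Real.pi)) := by
        rw [Gamma_mul_dSlope (Gamma_neg_half_ne_zero hν), mul_neg, hvalue,
          Real.sqrt_div zero_le_two, Complex.ofReal_div, hsqrt, mul_neg]
    _ = -1 := by field_simp

theorem dValue_ne_zero {ν : ℂ} (hν : ∀ n : ℕ, ν ≠ n) : dValue ν ≠ 0 := fun h => by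
  simpa [h] using sqrt_two_div_pi_mul_Gamma_mul_dValue_mul_dSlope hν

/-- The factor `√(2/π) Γ(-ν) y_even(ν, b) y_odd(ν, b)` of `M(ν)` that multiplies `D_ν(b)²`. -/
noncomputable def eigWeight (b : ℝ) (ν : ℂ) : ℂ :=
  (Real.sqrt (2 / Real.pi) : ℂ) * Gamma (-ν) * yEven ν b * yOdd ν b

theorem eigM_eq_eigWeight_mul (b : ℝ) (ν : ℂ) :
    eigM b ν = eigWeight b ν * parabolicD ν b ^ 2 := by
  rw [eigM, eigWeight]
  ring

theorem analyticAt_eigWeight (b : ℝ) {ν : ℂ} (hν : ∀ n : ℕ, ν ≠ n) :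
    AnalyticAt ℂ (eigWeight b) ν := by
  have hΓinv : AnalyticAt ℂ (fun ν : ℂ => (Gamma (-ν))⁻¹) ν :=
    (Complex.differentiable_one_div_Gamma.comp differentiable_neg).analyticAt ν
  have hΓ : AnalyticAt ℂ (fun ν : ℂ => Gamma (-ν)) ν := by
    simpa only [inv_inv] using hΓinv.fun_inv (inv_ne_zero (Gamma_neg_ne_zero hν))
  exact ((analyticAt_const.mul hΓ).mul ((differentiable_yEven_left b).analyticAt ν)).mul
    ((differentiable_yOdd_left b).analyticAt ν)

theorem eigWeight_eq_sq {b : ℝ} {l : ℂ} (hl : ∀ n : ℕ, l ≠ n) (h : parabolicD l b = 0) :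
    eigWeight b l = (yOdd l b / dValue l) ^ 2 := by
  have hvalue := dValue_ne_zero hl
  rw [parabolicD] at h
  rw [div_pow, eq_div_iff (pow_ne_zero 2 hvalue), eigWeight]
  linear_combination Real.sqrt (2 / Real.pi) * Gamma (-l) * dValue l * yOdd l b * h -
    yOdd l b ^ 2 * sqrt_two_div_pi_mul_Gamma_mul_dValue_mul_dSlope hl

theorem yOdd_ne_zero_of_parabolicD_eq_zero {l x : ℂ} (hl : ∀ n : ℕ, l ≠ n)
    (h : parabolicD l x = 0) : yOdd l x ≠ 0 := fun hodd => by
  refine yOdd_ne_zero_of_yEven_eq_zero ?_ hodd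
  simpa [parabolicD, hodd, dValue_ne_zero hl] using h

theorem conj_deriv_parabolicD (b : ℝ) (ν : ℂ) :
    conj (deriv (fun ν => parabolicD ν b) ν) = deriv (fun ν => parabolicD ν b) (conj ν) := by
  have hself : conj ∘ (fun ν => parabolicD ν b) ∘ conj = fun ν => parabolicD ν b :=
    funext fun ν => by simp [conj_parabolicD_ofReal]
  have hderiv := ((differentiable_parabolicD_left b) ν).hasDerivAt.conj_conj
  rw [hself] at hderiv
  exact hderiv.deriv.symm

theorem exists_eigWeight_mul_deriv_sq_eq {b : ℝ} {l : ℂ} (hl : ∀ n : ℕ, l ≠ n)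
    (h : parabolicD l b = 0) :
    ∃ c : ℝ, 0 < c ∧ eigWeight b l * deriv (fun ν => parabolicD ν b) l ^ 2 = c := by
  have hconj := conj_eq_self_of_parabolicD_eq_zero h
  obtain ⟨r, hr⟩ := Complex.conj_eq_iff_real.1 (show
    conj (yOdd l b / dValue l * deriv (fun ν => parabolicD ν b) l) =
      yOdd l b / dValue l * deriv (fun ν => parabolicD ν b) l by
    rw [map_mul, map_div₀, conj_yOdd, conj_dValue, conj_deriv_parabolicD, hconj,
      Complex.conj_ofReal])
  have hr0 : r ≠ 0 := by
    rw [← Complex.ofReal_ne_zero, ← hr]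
    exact mul_ne_zero (div_ne_zero (yOdd_ne_zero_of_parabolicD_eq_zero hl h) (dValue_ne_zero hl))
      (deriv_parabolicD_ne_zero h)
  refine ⟨r ^ 2, by positivity, ?_⟩
  rw [eigWeight_eq_sq hl h, ← mul_pow, hr, Complex.ofReal_pow]

theorem isBigO_mul_sq_sub {𝕜 : Type*} [NontriviallyNormedField 𝕜] {f k : 𝕜 → 𝕜} {l : 𝕜}
    (hf : AnalyticAt 𝕜 f l) (hk : DifferentiableAt 𝕜 k l) (hzero : f l = 0) :
    (fun z => k z * f z ^ 2 - k l * deriv f l ^ 2 * (z - l) ^ 2) =O[𝓝 l]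
      fun z => (z - l) ^ 3 := by
  have hslope : DifferentiableAt 𝕜 (fun z => k z * dslope f l z ^ 2) l := by
    obtain ⟨p, hp⟩ := hf
    exact hk.mul (hp.has_fpower_series_dslope_fslope.differentiableAt.pow 2)
  refine ((isBigO_refl (fun z => (z - l) ^ 2) (𝓝 l)).mul hslope.isBigO_sub).congr
    (fun z => ?_) fun z => by ring
  have hf_eq : f z = (z - l) * dslope f l z := by
    simpa [hzero] using (sub_smul_dslope f l z).symm
  rw [dslope_same, hf_eq]
  ring

theorem ne_natCast_of_parabolicD_eq_zero {b : ℝ} {l : ℝ} (hl : ∀ n : ℕ, 0 < n → l ≠ n)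
    (h : parabolicD l b = 0) (n : ℕ) : (l : ℂ) ≠ n := fun hn => by
  have hln : l = n := by exact_mod_cast hn
  have hpos : (0 : ℝ) < n := by
    simpa [hln] using (im_eq_zero_and_re_pos_of_parabolicD_eq_zero h).2
  exact hl n (Nat.cast_pos.1 hpos) hln

end Weber

theorem mainTheorem6_general (b : ℝ) :
    (∀ l : ℂ, Weber.parabolicD l b = 0 → l.im = 0 ∧ 0 < l.re) ∧
    (∀ l : ℂ, Weber.parabolicD l b = 0 →
      analyticOrderAt (fun ν => Weber.parabolicD ν b) l = 1) ∧
    (∀ l : ℝ, (∀ n : ℕ, 0 < n → l ≠ n) → Weber.parabolicD l b = 0 →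
      AnalyticAt ℂ (Weber.eigM b) l ∧
      ∃ c₂ : ℝ, 0 < c₂ ∧
        (fun ν => Weber.eigM b ν - c₂ * (ν - l) ^ 2) =O[𝓝 (l : ℂ)] fun ν => (ν - l) ^ 3) := by
  refine ⟨fun l => Weber.im_eq_zero_and_re_pos_of_parabolicD_eq_zero,
    fun l => Weber.analyticOrderAt_parabolicD_eq_one, fun l hl h => ?_⟩
  have hl' := Weber.ne_natCast_of_parabolicD_eq_zero hl h
  have hD := (Weber.differentiable_parabolicD_left b).analyticAt l
  have hweight := Weber.analyticAt_eigWeight b hl'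
  obtain ⟨c₂, hc₂, hc₂_eq⟩ := Weber.exists_eigWeight_mul_deriv_sq_eq hl' h
  rw [funext (Weber.eigM_eq_eigWeight_mul b)]
  refine ⟨hweight.mul (hD.pow 2), c₂, hc₂, ?_⟩
  simpa only [hc₂_eq] using Weber.isBigO_mul_sq_sub hD hweight.differentiableAt h

theorem mainTheorem6 (b : ℝ) (hb : 0 < b) :
    (∀ l : ℂ, Weber.parabolicD l (b : ℂ) = 0 → l.im = 0 ∧ 0 < l.re) ∧
    (∀ l : ℝ, (∀ n : ℕ, 0 < n → l ≠ (n : ℝ)) → Weber.parabolicD (l : ℂ) (b : ℂ) = 0 →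
      analyticOrderAt (fun ν : ℂ => Weber.parabolicD ν (b : ℂ)) (l : ℂ) = 1) ∧
    (∀ l : ℝ, (∀ n : ℕ, 0 < n → l ≠ (n : ℝ)) → Weber.parabolicD (l : ℂ) (b : ℂ) = 0 →
      AnalyticAt ℂ (Weber.eigM b) (l : ℂ) ∧
      ∃ c₂ : ℝ, 0 < c₂ ∧
        (fun ν : ℂ => Weber.eigM b ν - (c₂ : ℂ) * (ν - (l : ℂ)) ^ 2)
          =O[𝓝 (l : ℂ)] fun ν : ℂ => (ν - (l : ℂ)) ^ 3) := by
  obtain ⟨hreal, hsimple, hexpansion⟩ := mainTheorem6_general b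
  exact ⟨hreal, fun l _ => hsimple l, hexpansion⟩
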